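/- For integers $n,k\ge 1$ let $\mathcal M_k$ be the class of monotonic distributions on an alphabet of size $k$, i.e. of probability vectors $\theta=(\theta_1,\dots,\theta_k)$ with $\theta_1\ge\theta_2\ge\dots\ge\theta_k$. Logarithms are to base $2$. For $\theta\in\mathcal M_k$ let $P_\theta(x^n)=\prod_{t=1}^n\theta_{x_t}$ be the probability of $x^n\in\{1,\dots,k\}^n$ under the i.i.d. source $\theta$, and let $H_\theta[X]=-\sum_i\theta_i\log\theta_i$. A code is a length function $L:\{1,\dots,k\}^n\to\mathbb R$ with $\sum_{x^n}2^{-L(x^n)}\le 1$ (integer length constraints are ignored), and its average per-symbol redundancy for $\theta$ is $R_n(L,\theta)=\frac1n\sum_{x^n}P_\theta(x^n)L(x^n)-H_\theta[X]$. The $n$th-order average minimax and maximin redundancies of $\mathcal M_k$ are $$R_n^+(\mathcal M_k)=\inf_L\sup_{\theta\in\mathcal M_k}R_n(L,\theta),\qquad R_n^-(\mathcal M_k)=\sup_w\inf_L\int_{\mathcal M_k}R_n(L,\theta)\,w(d\theta),$$ where $w$ ranges over the Borel probability measures on $\mathcal M_k$. **Theorem.** Fix $\varepsilon>0$. There are a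 constant $C>0$ and an integer $N$, depending only on $\varepsilon$, such that for all $n\ge \max(N,1)$ and all $k\ge 1$ both $R=R_n^-(\mathcal M_k)$ and $R=R_n^+(\mathcal M_k)$ satisfy $$R\ \ge\ \frac{k-1}{2n}\log\frac{n^{1-\varepsilon}}{k^3}+\frac{k-1}{2n}\log\frac{\pi e^3}{2}-C\,\frac{\log k}{n}\qquad\text{if } k\le\Big(\frac{\pi n^{1-\varepsilon}}{2}\Big)^{1/3},$$ $$R\ \ge\ \Big(\frac{\pi}{2}\Big)^{1/3}(1.5\log e)\,\frac{n^{(1-\varepsilon)/3}}{n}-C\,\frac{\log n}{n}\qquad\text{if } k>\Big(\frac{\pi n^{1-\varepsilon}}{2}\Big)^{1/3}.$$ -/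

import Mathlib

open MeasureTheory

noncomputable section

/-- The parameter vectors of the i.i.d. sources over an alphabet of size `k`: probability vectors
`(θ i)` indexed by `Fin k` (the letters `1, …, k` of the alphabet are the indices `0, …, k - 1`). -/
abbrev Source (k : ℕ) : Type := stdSimplex ℝ (Fin k)

/-- The class of monotonic distributions over an alphabet of size `k`:
`θ 0 ≥ θ 1 ≥ … ≥ θ (k - 1)`. -/
def monotoneClass (k : ℕ) : Set (Source k) :=
  {θ | ∀ i j : Fin k, i ≤ j → θ.1 j ≤ θ.1 i}

/-- The probability of the sequence `x` under the i.i.d. source `θ`. -/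
def seqProb {n k : ℕ} (θ : Source k) (x : Fin n → Fin k) : ℝ :=
  ∏ t, θ.1 (x t)

/-- The per-symbol entropy of `θ`, in bits. -/
def entropyBits {k : ℕ} (θ : Source k) : ℝ :=
  -∑ i, θ.1 i * Real.logb 2 (θ.1 i)

/-- The length function, in bits, of a code for sequences of length `n` over an alphabet of
size `k`. Integer length constraints are ignored, so such a function is a real-valued one that
satisfies the Kraft inequality; equivalently it is `-log₂ Q` for some `Q > 0` of total mass at
most one. -/
structure CodeLength (n k : ℕ) where
  len : (Fin n → Fin k) → ℝ
  kraft : ∑ x, (2 : ℝ) ^ (-len x) ≤ 1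

/-- The average per-symbol `n`th-order redundancy `(1/n) E_θ L[X^n] - H_θ[X]`. -/
def redundancy {n k : ℕ} (L : CodeLength n k) (θ : Source k) : ℝ :=
  1 / (n : ℝ) * (∑ x, seqProb θ x * L.len x) - entropyBits θ

/-- The average minimax redundancy of a class `Λ` of sources. -/
def minimaxRedundancy (n : ℕ) {k : ℕ} (Λ : Set (Source k)) : EReal :=
  ⨅ L : CodeLength n k, ⨆ θ : Λ, ((redundancy L (θ : Source k) : ℝ) : EReal)

/-- The average maximin redundancy of a class `Λ` of sources; the priors are the Borel
probability measures on `Λ`. -/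
def maximinRedundancy (n : ℕ) {k : ℕ} (Λ : Set (Source k)) : EReal :=
  ⨆ w : ProbabilityMeasure Λ, ⨅ L : CodeLength n k,
    ((∫ θ : Λ, redundancy L (θ : Source k) ∂(w : Measure Λ) : ℝ) : EReal)

end

/-! Redundancy is a divergence, so its average over a finite family of sources is at least the
logarithm of the number of members that $n$ samples can tell apart. In the coordinates
$\sqrt{\theta_i}$ the Bhattacharyya coefficient of two $n$-fold products is at most
$e^{-n|\cdot|^2/2}$, so sources on a grid of spacing $1/\sqrt n$ are distinguishable up to a
constant factor per coordinate. Giving each of $d$ letters its own block of $m$ grid values, with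
the blocks in decreasing order, makes every grid point monotonic. There is room for this if
$2d(dm)^2\le n$, and `neg_card_mul_log_le_sum_divergence` then yields `grid_lower_bound`, $\frac
dn\log\frac m6$. With $d=l-1$ and $m\approx\sqrt{n/(2l^3)}$ this is $\frac{l-1}{2n}\log\frac n{l^3}$
up to constants inside the logarithm, which the spare factor $n^\varepsilon$ absorbs
(`small_alphabet_bound`). Above the threshold the same bound is used with only as many letters as
the threshold allows. -/

/-! ### Divergence from pairwise Bhattacharyya coefficients. -/

/-- Mutual-information lower bound by pairwise Bhattacharyya coefficients, in the form of a lower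
bound on the total divergence of a finite family from an arbitrary subprobability vector `q`. -/
theorem neg_card_mul_log_le_sum_divergence {J X : Type*} [Fintype J] [Nonempty J] [Fintype X]
    (p : J → X → ℝ) (hp : ∀ j x, 0 ≤ p j x) (hp1 : ∀ j, ∑ x, p j x = 1)
    (q : X → ℝ) (hq : ∀ x, 0 < q x) (hq1 : ∑ x, q x ≤ 1) (B : ℝ) (hB : 0 < B)
    (hpB : ∀ i, ∑ j, ∑ x, √(p i x) * √(p j x) ≤ Fintype.card J * B) :
    -((Fintype.card J : ℝ) * Real.log B) ≤
      ∑ i, ∑ x, p i x * (Real.log (p i x) - Real.log (q x)) := by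
  set M : ℝ := (Fintype.card J : ℝ) with hM
  have hM0 : 0 < M := by rw [hM]; exact_mod_cast Fintype.card_pos
  set S : X → ℝ := fun x => ∑ j, √(p j x) with hS
  have hS0 : ∀ x, 0 ≤ S x := fun x => Finset.sum_nonneg fun j _ => Real.sqrt_nonneg _
  -- With $s=\sqrt{p_i}$, the bound $\log t\le t-1$ is applied to $Mq/(sS)$ and to $S/(MsB)$, whose
  -- product is $q/(p_iB)$: the weight $S$ cancels. After summation each of the two linear terms
  -- costs at most $M$.
  have key : ∀ i x, 2 * p i x - M * (q x * (√(p i x) / S x)) - √(p i x) * S x / (M * B)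
      - p i x * Real.log B ≤ p i x * (Real.log (p i x) - Real.log (q x)) := by
    intro i x
    rcases (hp i x).eq_or_lt with h | h
    · simp [← h]
    · have hs : 0 < √(p i x) := Real.sqrt_pos.2 h
      have hSx : 0 < S x := lt_of_lt_of_le hs
        (Finset.single_le_sum (f := fun j => √(p j x)) (fun j _ => Real.sqrt_nonneg _)
          (Finset.mem_univ i))
      have hsq : p i x = √(p i x) * √(p i x) := (Real.mul_self_sqrt h.le).symm
      generalize √(p i x) = s at *
      have hqx := hq x
      have e1 := Real.log_le_sub_one_of_pos (x := M * q x / (s * S x)) (by positivity)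
      have e2 := Real.log_le_sub_one_of_pos (x := S x / (M * s * B)) (by positivity)
      rw [Real.log_div (by positivity) (by positivity), Real.log_mul hM0.ne' hqx.ne',
        Real.log_mul hs.ne' hSx.ne'] at e1
      rw [Real.log_div hSx.ne' (by positivity), Real.log_mul (by positivity) hB.ne',
        Real.log_mul hM0.ne' hs.ne'] at e2
      have e3 : 2 - M * q x / (s * S x) - S x / (M * s * B) - Real.log B
          ≤ Real.log (p i x) - Real.log (q x) := by
        rw [hsq, Real.log_mul hs.ne' hs.ne']; linarith
      refine le_trans (le_of_eq ?_) (mul_le_mul_of_nonneg_left e3 h.le)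
      rw [hsq]; field_simp
  have h1 : ∑ i, ∑ x, M * (q x * (√(p i x) / S x)) ≤ M := by
    rw [Finset.sum_comm]
    calc ∑ x, ∑ i, M * (q x * (√(p i x) / S x)) = ∑ x, M * (q x * (S x / S x)) := by
          refine Finset.sum_congr rfl fun x _ => ?_
          rw [← Finset.mul_sum, ← Finset.mul_sum, ← Finset.sum_div]
      -- Where $S$ vanishes the quotient $S/S$ is $0$, hence an inequality.
      _ ≤ ∑ x, M * q x := by
          refine Finset.sum_le_sum fun x _ => ?_
          have := mul_le_mul_of_nonneg_left (div_self_le_one (S x)) (hq x).le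
          nlinarith
      _ ≤ M := by rw [← Finset.mul_sum]; nlinarith
  have h2 : ∑ i, ∑ x, √(p i x) * S x / (M * B) ≤ M := by
    calc ∑ i, ∑ x, √(p i x) * S x / (M * B) ≤ ∑ i : J, (1 : ℝ) := by
          refine Finset.sum_le_sum fun i _ => ?_
          rw [← Finset.sum_div, div_le_one (by positivity)]
          refine le_trans (le_of_eq ?_) (hpB i)
          rw [Finset.sum_comm]
          exact Finset.sum_congr rfl fun x _ => Finset.mul_sum _ _ _
      _ = M := by simp [hM]
  have h3 : ∑ i, ∑ x, p i x = M := by simp [hp1, hM]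
  calc -(M * Real.log B) = 2 * M - M - M - M * Real.log B := by ring
    _ ≤ 2 * (∑ i, ∑ x, p i x) - ∑ i, ∑ x, M * (q x * (√(p i x) / S x))
        - ∑ i, ∑ x, √(p i x) * S x / (M * B) - (∑ i, ∑ x, p i x) * Real.log B := by
          rw [h3]; linarith
    _ = ∑ i, ∑ x, (2 * p i x - M * (q x * (√(p i x) / S x)) - √(p i x) * S x / (M * B)
      - p i x * Real.log B) := by
          simp only [Finset.sum_sub_distrib, Finset.mul_sum, Finset.sum_mul]
    _ ≤ _ := Finset.sum_le_sum fun i _ => Finset.sum_le_sum fun x _ => key i x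

/-! ### Divergence and Hellinger distance for i.i.d. sources. -/

theorem seqProb_nonneg {n k : ℕ} (θ : Source k) (x : Fin n → Fin k) : 0 ≤ seqProb θ x :=
  Finset.prod_nonneg fun _ _ => θ.2.1 _

theorem sum_prod_comp {n k : ℕ} (g : Fin n → Fin k → ℝ) :
    ∑ x : Fin n → Fin k, ∏ t, g t (x t) = ∏ t, ∑ i, g t i := by
  rw [Finset.prod_univ_sum, Fintype.piFinset_univ]

theorem sum_seqProb {n k : ℕ} (θ : Source k) : ∑ x : Fin n → Fin k, seqProb θ x = 1 := by
  simp only [seqProb]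
  rw [sum_prod_comp (fun _ i => θ.1 i)]
  simp [θ.2.2]

theorem sum_seqProb_mul_sum {n k : ℕ} (θ : Source k) (f : Fin k → ℝ) :
    ∑ x : Fin n → Fin k, seqProb θ x * ∑ t, f (x t) = n * ∑ i, θ.1 i * f i := by
  simp only [Finset.mul_sum]
  rw [Finset.sum_comm]
  have h : ∀ t : Fin n, ∑ x : Fin n → Fin k, seqProb θ x * f (x t) = ∑ i, θ.1 i * f i := by
    intro t
    -- Absorbing $f$ into the factor at position $t$ keeps the summand a product over positions.
    have e : ∀ x : Fin n → Fin k, seqProb θ x * f (x t)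
        = ∏ s, (fun s i => θ.1 i * if s = t then f i else 1) s (x s) := by
      intro x
      simp only [Finset.prod_mul_distrib, seqProb]
      simp
    rw [Finset.sum_congr rfl fun x _ => e x,
      sum_prod_comp fun s i => θ.1 i * if s = t then f i else 1, Finset.prod_eq_single t]
    · simp
    · intro s _ hs
      simp [hs, θ.2.2]
    · simp
  simp [h, Finset.mul_sum]

theorem seqProb_mul_log {n k : ℕ} (θ : Source k) (x : Fin n → Fin k) :
    seqProb θ x * Real.log (seqProb θ x) = seqProb θ x * ∑ t, Real.log (θ.1 (x t)) := by
  by_cases h : seqProb θ x = 0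
  · simp [h]
  · congr 1
    rw [seqProb, Real.log_prod]
    exact fun t _ => Finset.prod_ne_zero_iff.1 h t (Finset.mem_univ t)

/-- The entropy of the product source is $n$ times that of one letter, so redundancy becomes the
divergence (in nats) from the coding measure $2^{-L}$. -/
theorem redundancy_eq_divergence {n k : ℕ} (hn : 1 ≤ n) (L : CodeLength n k) (θ : Source k) :
    n * Real.log 2 * redundancy L θ =
      ∑ x, seqProb θ x * (Real.log (seqProb θ x) - Real.log ((2 : ℝ) ^ (-L.len x))) := by
  have hn' : (n : ℝ) ≠ 0 := by positivity
  have h2 : Real.log 2 ≠ 0 := by positivity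
  have e : ∀ x, seqProb θ x * (Real.log (seqProb θ x) - Real.log ((2 : ℝ) ^ (-L.len x)))
      = seqProb θ x * ∑ t, Real.log (θ.1 (x t)) + Real.log 2 * (seqProb θ x * L.len x) := by
    intro x
    rw [mul_sub, seqProb_mul_log, Real.log_rpow two_pos]; ring
  simp only [e, Finset.sum_add_distrib]
  rw [sum_seqProb_mul_sum θ fun i => Real.log (θ.1 i), ← Finset.mul_sum, redundancy, entropyBits]
  simp only [Real.logb, mul_div_assoc']
  rw [← Finset.sum_div]
  field_simp
  ring

theorem sum_sqrt_seqProb {n k : ℕ} (θ θ' : Source k) :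
    ∑ x : Fin n → Fin k, √(seqProb θ x) * √(seqProb θ' x)
      = (∑ i, √(θ.1 i) * √(θ'.1 i)) ^ n := by
  have e : ∀ x : Fin n → Fin k, √(seqProb θ x) * √(seqProb θ' x)
      = ∏ t, (fun _ i => √(θ.1 i) * √(θ'.1 i)) t (x t) := by
    intro x
    rw [seqProb, seqProb, Real.sqrt_prod _ fun t _ => θ.2.1 _,
      Real.sqrt_prod _ fun t _ => θ'.2.1 _, Finset.prod_mul_distrib]
  rw [Finset.sum_congr rfl fun x _ => e x,
    sum_prod_comp fun _ i => √(θ.1 i) * √(θ'.1 i)]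
  simp

theorem sum_sqrt_mul_sqrt {k : ℕ} (θ θ' : Source k) :
    ∑ i, √(θ.1 i) * √(θ'.1 i) = 1 - (∑ i, (√(θ.1 i) - √(θ'.1 i)) ^ 2) / 2 := by
  have e : ∀ i, (√(θ.1 i) - √(θ'.1 i)) ^ 2
      = θ.1 i + θ'.1 i - 2 * (√(θ.1 i) * √(θ'.1 i)) := by
    intro i
    nlinarith [Real.sq_sqrt (θ.2.1 i), Real.sq_sqrt (θ'.2.1 i)]
  simp only [e, Finset.sum_sub_distrib, Finset.sum_add_distrib, ← Finset.mul_sum]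
  have h1 : ∑ i, θ.1 i = 1 := θ.2.2
  have h2 : ∑ i, θ'.1 i = 1 := θ'.2.2
  rw [h1, h2]; ring

/-- The coefficient of a product is the $n$-th power of the one-letter coefficient, and $1-u\le
e^{-u}$. -/
theorem sum_sqrt_seqProb_le_exp {n k : ℕ} (θ θ' : Source k) :
    ∑ x : Fin n → Fin k, √(seqProb θ x) * √(seqProb θ' x)
      ≤ Real.exp (-(n * (∑ i, (√(θ.1 i) - √(θ'.1 i)) ^ 2) / 2)) := by
  rw [sum_sqrt_seqProb]
  have h : ∑ i, √(θ.1 i) * √(θ'.1 i)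
      ≤ Real.exp (-((∑ i, (√(θ.1 i) - √(θ'.1 i)) ^ 2) / 2)) := by
    rw [sum_sqrt_mul_sqrt]
    linarith [Real.add_one_le_exp (-((∑ i, (√(θ.1 i) - √(θ'.1 i)) ^ 2) / 2))]
  refine (pow_le_pow_left₀ (Finset.sum_nonneg fun i _ => by positivity) h n).trans ?_
  rw [← Real.exp_nat_mul]
  apply le_of_eq
  congr 1
  ring

/-! ### From finite families to maximin and minimax. -/

/-- A lower bound on the redundancy averaged over a finite family bounds the maximin and minimax
redundancies. -/
theorem le_minimax_of_forall_avg {n k : ℕ} {Λ : Set (Source k)} {J : Type*} [Fintype J]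
    [Nonempty J] (θ : J → Λ) (b : ℝ)
    (h : ∀ L : CodeLength n k, Fintype.card J * b ≤ ∑ j, redundancy L (θ j : Source k)) :
    ∀ R ∈ ({maximinRedundancy n Λ, minimaxRedundancy n Λ} : Set EReal), (b : EReal) ≤ R := by
  have hM : (0 : ℝ) < Fintype.card J := by exact_mod_cast Fintype.card_pos
  intro R hR
  rcases hR with rfl | rfl
  · let c : ENNReal := (Fintype.card J : ENNReal)⁻¹
    -- The prior is uniform on the family, counted with multiplicity.
    let μ : Measure Λ := ∑ j, c • Measure.dirac (θ j)
    have hμ : IsProbabilityMeasure μ := by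
      constructor
      simp only [μ, c, Measure.coe_finsetSum, Finset.sum_apply, Measure.smul_apply,
        measure_univ, smul_eq_mul, mul_one, Finset.sum_const, Finset.card_univ, nsmul_eq_mul]
      exact ENNReal.mul_inv_cancel (by simp) (by simp)
    refine le_iSup_of_le ⟨μ, hμ⟩ (le_iInf fun L => ?_)
    rw [EReal.coe_le_coe_iff]
    change b ≤ ∫ θ : Λ, redundancy L (θ : Source k) ∂μ
    rw [integral_finsetSum_measure]
    · simp only [integral_smul_measure, integral_dirac]
      simp only [c, smul_eq_mul, ← Finset.mul_sum, ENNReal.toReal_inv, ENNReal.toReal_natCast]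
      rw [inv_mul_eq_div, le_div_iff₀ hM, mul_comm]
      exact h L
    · intro j _
      exact (integrable_dirac (by simp)).smul_measure (by simp [c])
  · refine le_iInf fun L => ?_
    obtain ⟨j, -, hj⟩ := Finset.exists_le_of_sum_le (s := (Finset.univ : Finset J))
      (f := fun _ => b) (g := fun j => redundancy L (θ j : Source k)) Finset.univ_nonempty
      (by simpa using h L)
    exact le_iSup_of_le (θ j) (EReal.coe_le_coe_iff.2 hj)

/-! ### The grid of monotonic sources. -/

/-- Square-root coordinates, in units of `1 / √n`: the `i`-th one ranges over the `i`-th highest of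
`d` consecutive blocks of `m` integers. -/
def gridCoord {d m : ℕ} (a : Fin d → Fin m) (i : ℕ) : ℕ :=
  if h : i < d then (d - 1 - i) * m + a ⟨i, h⟩ else 0

theorem gridCoord_le {d m : ℕ} (a : Fin d → Fin m) (i : ℕ) : gridCoord a i ≤ d * m := by
  unfold gridCoord
  split_ifs with h
  · have := (a ⟨i, h⟩).2
    calc (d - 1 - i) * m + a ⟨i, h⟩ ≤ (d - 1 - i + 1) * m := by rw [add_mul]; omega
      _ ≤ d * m := Nat.mul_le_mul_right _ (by omega)
  · exact Nat.zero_le _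

theorem gridCoord_antitone {d m : ℕ} (a : Fin d → Fin m) : Antitone (gridCoord a) := by
  refine antitone_nat_of_succ_le fun i => ?_
  unfold gridCoord
  split_ifs with h h' h'
  · have := (a ⟨i + 1, h⟩).2
    calc (d - 1 - (i + 1)) * m + a ⟨i + 1, h⟩ ≤ (d - 1 - (i + 1) + 1) * m := by
          rw [add_mul]; omega
      _ ≤ (d - 1 - i) * m := Nat.mul_le_mul_right _ (by omega)
      _ ≤ _ := Nat.le_add_right _ _
  · omega
  · exact Nat.zero_le _
  · exact le_rfl

/-- The letter probabilities of the grid point `a`. -/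
noncomputable def gridWeight (n : ℕ) {d m : ℕ} (a : Fin d → Fin m) : ℕ → ℝ
  | 0 => 1 - ∑ i ∈ Finset.range d, (gridCoord a i : ℝ) ^ 2 / n
  | i + 1 => (gridCoord a i : ℝ) ^ 2 / n

theorem sum_gridCoord_sq_le {n d m : ℕ} (hn : 1 ≤ n) (h : 2 * (d * (d * m) ^ 2) ≤ n)
    (a : Fin d → Fin m) :
    ∑ i ∈ Finset.range d, (gridCoord a i : ℝ) ^ 2 / n ≤ 1 / 2 := by
  have hn' : (0 : ℝ) < n := by exact_mod_cast hn
  have h' : 2 * ((d : ℝ) * ((d : ℝ) * m) ^ 2) ≤ n := by exact_mod_cast h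
  calc ∑ i ∈ Finset.range d, (gridCoord a i : ℝ) ^ 2 / n
      ≤ ∑ i ∈ Finset.range d, ((d : ℝ) * m) ^ 2 / n := by
        refine Finset.sum_le_sum fun i _ => ?_
        have : (gridCoord a i : ℝ) ≤ d * m := by exact_mod_cast gridCoord_le a i
        gcongr
    _ = d * ((d : ℝ) * m) ^ 2 / n := by simp [mul_div_assoc]
    _ ≤ 1 / 2 := by rw [div_le_iff₀ hn']; linarith

/-- The first letter keeps mass at least $1/2$, while all the others share at most $1/2$. -/
theorem gridWeight_antitone {n d m : ℕ} (hn : 1 ≤ n) (h : 2 * (d * (d * m) ^ 2) ≤ n)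
    (a : Fin d → Fin m) : Antitone (gridWeight n a) := by
  refine antitone_nat_of_succ_le fun i => ?_
  have hs := sum_gridCoord_sq_le hn h a
  cases i with
  | zero =>
    simp only [gridWeight]
    rcases Nat.eq_zero_or_pos d with rfl | hd
    · simp [gridCoord]
    · have := Finset.single_le_sum (f := fun i => (gridCoord a i : ℝ) ^ 2 / n)
        (fun i _ => by positivity) (Finset.mem_range.2 hd)
      linarith
  | succ i =>
    have : (gridCoord a (i + 1) : ℝ) ≤ gridCoord a i := by
      exact_mod_cast gridCoord_antitone a (Nat.le_succ i)
    simp only [gridWeight]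
    gcongr

theorem gridWeight_nonneg {n d m : ℕ} (hn : 1 ≤ n) (h : 2 * (d * (d * m) ^ 2) ≤ n)
    (a : Fin d → Fin m) (i : ℕ) : 0 ≤ gridWeight n a i := by
  have hs := sum_gridCoord_sq_le hn h a
  cases i with
  | zero => simp only [gridWeight]; linarith
  | succ i => simp only [gridWeight]; positivity

theorem sum_gridWeight {n k d m : ℕ} (hdk : d + 1 ≤ k) (a : Fin d → Fin m) :
    ∑ i : Fin k, gridWeight n a i = 1 := by
  obtain ⟨e, rfl⟩ : ∃ e, k = d + e + 1 := ⟨k - d - 1, by omega⟩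
  rw [Finset.sum_range (gridWeight n a) |>.symm, Finset.sum_range_succ', Finset.sum_range_add]
  have : ∑ x ∈ Finset.range e, gridWeight n a (d + x + 1) = 0 :=
    Finset.sum_eq_zero fun x _ => by simp [gridWeight, gridCoord]
  rw [this]
  simp [gridWeight]

/-- The monotonic source of the grid point `a`. -/
noncomputable def gridSource {n k d m : ℕ} (hn : 1 ≤ n) (h : 2 * (d * (d * m) ^ 2) ≤ n) (hdk : d + 1 ≤ k)
    (a : Fin d → Fin m) : monotoneClass k :=
  ⟨⟨fun i => gridWeight n a i, fun i => gridWeight_nonneg hn h a i, sum_gridWeight hdk a⟩,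
    fun _ _ hij => gridWeight_antitone hn h a hij⟩

/-- The $d$ free letters contribute exactly the left side; the first letter and the unused ones only
add nonnegative terms. -/
theorem sum_sq_sub_le_hellinger {n k d m : ℕ} (hn : 1 ≤ n) (h : 2 * (d * (d * m) ^ 2) ≤ n)
    (hdk : d + 1 ≤ k) (a b : Fin d → Fin m) :
    ∑ i, ((a i : ℝ) - b i) ^ 2 ≤
      n * ∑ i, (√((gridSource hn h hdk a).1.1 i) - √((gridSource hn h hdk b).1.1 i)) ^ 2 := by
  have hn' : (0 : ℝ) < n := by exact_mod_cast hn
  obtain ⟨e, rfl⟩ : ∃ e, k = d + e + 1 := ⟨k - d - 1, by omega⟩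
  change _ ≤ n * ∑ i : Fin (d + e + 1),
    (fun i : ℕ => (√(gridWeight n a i) - √(gridWeight n b i)) ^ 2) i
  rw [← Finset.sum_range fun i : ℕ => (√(gridWeight n a i) - √(gridWeight n b i)) ^ 2,
    Finset.sum_range_succ', Finset.sum_range_add, add_assoc]
  have e1 : ∀ i : Fin d, n * (√(gridWeight n a (i + 1)) - √(gridWeight n b (i + 1))) ^ 2
      = ((a i : ℝ) - b i) ^ 2 := by
    intro i
    simp only [gridWeight]
    rw [Real.sqrt_div (by positivity), Real.sqrt_div (by positivity),
      Real.sqrt_sq (by positivity), Real.sqrt_sq (by positivity), ← sub_div, div_pow,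
      Real.sq_sqrt hn'.le, mul_div_cancel₀ _ hn'.ne']
    simp [gridCoord]
  rw [mul_add, Finset.sum_range, Finset.mul_sum, Finset.sum_congr rfl fun i _ => e1 i]
  have : 0 ≤ ∑ x ∈ Finset.range e,
      (√(gridWeight n a (d + x + 1)) - √(gridWeight n b (d + x + 1))) ^ 2
      + (√(gridWeight n a 0) - √(gridWeight n b 0)) ^ 2 := by positivity
  nlinarith [mul_nonneg hn'.le this]

/-! ### Gaussian sums over the grid. -/

theorem sum_two_thirds_pow_le (n : ℕ) : ∑ i ∈ Finset.range n, (2 / 3 : ℝ) ^ i ≤ 3 := by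
  rw [geom_sum_eq (by norm_num)]
  have : (0 : ℝ) ≤ (2 / 3) ^ n := by positivity
  rw [div_le_iff_of_neg (by norm_num)]
  linarith

/-- For integer distances $d\le d^2$, and $e^{-1/2}\le 2/3$, so Gaussian decay is dominated by a
geometric one. -/
theorem exp_neg_sq_sub_le (i j : ℕ) (hij : i ≤ j) :
    Real.exp (-(((i : ℝ) - j) ^ 2 / 2)) ≤ (2 / 3) ^ (j - i) := by
  obtain ⟨d, rfl⟩ := Nat.exists_eq_add_of_le hij
  have h1 : Real.exp (-(1 / 2)) ≤ 2 / 3 := by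
    rw [Real.exp_neg, inv_le_comm₀ (Real.exp_pos _) (by norm_num)]
    linarith [Real.add_one_le_exp (1 / 2 : ℝ)]
  have h2 : (d : ℝ) ≤ (d : ℝ) ^ 2 := by
    have : d ≤ d ^ 2 := Nat.le_self_pow two_ne_zero d
    exact_mod_cast this
  calc Real.exp (-(((i : ℝ) - ((i + d : ℕ) : ℝ)) ^ 2 / 2)) ≤ Real.exp (d * (-(1 / 2))) := by
        apply Real.exp_le_exp.2
        push_cast
        nlinarith
    _ = Real.exp (-(1 / 2)) ^ d := Real.exp_nat_mul _ _
    _ ≤ (2 / 3) ^ d := pow_le_pow_left₀ (Real.exp_pos _).le h1 d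
    _ = _ := by simp

/-- Each side of $i$ is dominated by a geometric series of sum $3$. -/
theorem sum_exp_neg_sq_sub_le {m : ℕ} (i : Fin m) :
    ∑ j : Fin m, Real.exp (-(((i : ℝ) - (j : ℕ)) ^ 2 / 2)) ≤ 6 := by
  rw [← Finset.sum_range fun j : ℕ => Real.exp (-(((i : ℕ) - (j : ℝ)) ^ 2 / 2)),
    ← Finset.sum_range_add_sum_Ico _ (show (i : ℕ) + 1 ≤ m from i.2)]
  have h1 : ∑ j ∈ Finset.range ((i : ℕ) + 1), Real.exp (-(((i : ℕ) - (j : ℝ)) ^ 2 / 2)) ≤ 3 := by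
    refine le_trans ?_ (sum_two_thirds_pow_le ((i : ℕ) + 1))
    rw [← Finset.sum_range_reflect (fun j => (2 / 3 : ℝ) ^ j)]
    refine Finset.sum_le_sum fun j hj => ?_
    have hj' := Finset.mem_range.1 hj
    rw [← neg_sub, neg_sq]
    exact exp_neg_sq_sub_le j i (by omega)
  have h2 : ∑ j ∈ Finset.Ico ((i : ℕ) + 1) m, Real.exp (-(((i : ℕ) - (j : ℝ)) ^ 2 / 2)) ≤ 3 := by
    rw [Finset.sum_Ico_eq_sum_range]
    refine le_trans (Finset.sum_le_sum fun j _ => ?_) (sum_two_thirds_pow_le (m - (i + 1)))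
    refine (exp_neg_sq_sub_le i (i + 1 + j) (by omega)).trans ?_
    exact pow_le_pow_of_le_one (by norm_num) (by norm_num) (by omega)
  linarith

theorem sum_exp_neg_sum_sq_sub_le {d m : ℕ} (a : Fin d → Fin m) :
    ∑ b : Fin d → Fin m, Real.exp (-((∑ i, ((a i : ℝ) - (b i : ℕ)) ^ 2) / 2)) ≤ 6 ^ d := by
  have e : ∀ b : Fin d → Fin m, Real.exp (-((∑ i, ((a i : ℝ) - (b i : ℕ)) ^ 2) / 2))
      = ∏ i, (fun i j => Real.exp (-(((a i : ℝ) - ((j : Fin m) : ℕ)) ^ 2 / 2))) i (b i) := by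
    intro b
    rw [← Real.exp_sum, Finset.sum_neg_distrib, Finset.sum_div]
  rw [Finset.sum_congr rfl fun b _ => e b, sum_prod_comp fun i j =>
    Real.exp (-(((a i : ℝ) - ((j : Fin m) : ℕ)) ^ 2 / 2))]
  refine (Finset.prod_le_prod (fun i _ => by positivity)
    fun i _ => sum_exp_neg_sq_sub_le (a i)).trans ?_
  simp

/-! ### Redundancy bounds from the grid. -/

/-- Redundancy lower bound from a product grid with `d` free coordinates and `m` values each. -/
theorem grid_lower_bound {n k d m : ℕ} (hn : 1 ≤ n) (hm : 1 ≤ m) (hdk : d + 1 ≤ k)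
    (h : 2 * (d * (d * m) ^ 2) ≤ n) :
    ∀ R ∈ ({maximinRedundancy n (monotoneClass k),
        minimaxRedundancy n (monotoneClass k)} : Set EReal),
      (((d : ℝ) / n * Real.logb 2 (m / 6) : ℝ) : EReal) ≤ R := by
  have : Nonempty (Fin m) := ⟨⟨0, hm⟩⟩
  have hn' : (0 : ℝ) < n := by exact_mod_cast hn
  have hm' : (0 : ℝ) < m := by exact_mod_cast hm
  have hl2 : 0 < Real.log 2 := Real.log_pos one_lt_two
  refine le_minimax_of_forall_avg (gridSource hn h hdk) _ fun L => ?_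
  have key := neg_card_mul_log_le_sum_divergence
    (fun (a : Fin d → Fin m) (x : Fin n → Fin k) => seqProb (gridSource hn h hdk a).1 x)
    (fun _ _ => seqProb_nonneg _ _) (fun _ => sum_seqProb _)
    (fun x => (2 : ℝ) ^ (-L.len x)) (fun x => by positivity) L.kraft ((6 / m) ^ d)
    (by positivity) ?_
  · simp only [← redundancy_eq_divergence hn] at key
    rw [← Finset.mul_sum, Real.log_pow, ← inv_div, Real.log_inv] at key
    rw [Real.logb]
    have hpos : 0 < n * Real.log 2 := by positivity
    refine le_of_mul_le_mul_left (le_trans (le_of_eq ?_) key) hpos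
    field_simp
  · intro a
    calc _ ≤ ∑ b : Fin d → Fin m, Real.exp (-((∑ i, ((a i : ℝ) - (b i : ℕ)) ^ 2) / 2)) := by
          refine Finset.sum_le_sum fun b _ => (sum_sqrt_seqProb_le_exp _ _).trans ?_
          have := sum_sq_sub_le_hellinger hn h hdk a b
          apply Real.exp_le_exp.2
          linarith
      _ ≤ 6 ^ d := sum_exp_neg_sum_sq_sub_le a
      _ = _ := by
          simp only [Fintype.card_pi, Fintype.card_fin, Finset.prod_const, Finset.card_univ]
          push_cast
          rw [← mul_pow, mul_div_cancel₀ _ hm'.ne']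

/-- The bound for alphabets below the threshold `(π n ^ (1 - ε) / 2) ^ (1 / 3)`, valid for any
larger ambient alphabet. -/
theorem small_alphabet_bound {ε : ℝ} {n k l : ℕ} (hn : 1 ≤ n) (hl : 1 ≤ l) (hlk : l ≤ k)
    (hln : (l : ℝ) ^ 3 ≤ Real.pi * (n : ℝ) ^ (1 - ε) / 2)
    (hnε : 144 * Real.pi * Real.exp 1 ^ 3 ≤ (n : ℝ) ^ ε) :
    ∀ R ∈ ({maximinRedundancy n (monotoneClass k),
        minimaxRedundancy n (monotoneClass k)} : Set EReal),
      (((((l : ℝ) - 1) / (2 * n)) * Real.logb 2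
        ((n : ℝ) ^ (1 - ε) / (l : ℝ) ^ 3 * (Real.pi * Real.exp 1 ^ 3 / 2)) : ℝ) : EReal) ≤ R := by
  have hn' : (0 : ℝ) < n := by exact_mod_cast hn
  have hl' : (0 : ℝ) < l := by exact_mod_cast hl
  have hpi := Real.pi_pos
  have hprod : (n : ℝ) = (n : ℝ) ^ (1 - ε) * (n : ℝ) ^ ε := by
    rw [← Real.rpow_add hn']; simp
  have hA : 0 < (n : ℝ) ^ (1 - ε) := Real.rpow_pos_of_pos hn' _
  have he3 : 1 ≤ Real.exp 1 ^ 3 := one_le_pow₀ (Real.one_le_exp zero_le_one)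
  have hpE : Real.pi ≤ (n : ℝ) ^ ε := le_trans (by nlinarith) hnε
  generalize (n : ℝ) ^ ε = E at *
  generalize (n : ℝ) ^ (1 - ε) = A at *
  -- The block size will be the largest integer $m$ with $2l^3m^2\le n$; it is positive because
  -- $2l^3\le\pi n^{1-\varepsilon}\le n$.
  have hy1 : 1 ≤ √((n : ℝ) / (2 * (l : ℝ) ^ 3)) := by
    rw [Real.one_le_sqrt, one_le_div (by positivity), hprod]
    nlinarith
  have hysq : √((n : ℝ) / (2 * (l : ℝ) ^ 3)) ^ 2 = (n : ℝ) / (2 * (l : ℝ) ^ 3) :=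
    Real.sq_sqrt (by positivity)
  generalize √((n : ℝ) / (2 * (l : ℝ) ^ 3)) = y at *
  have hm1 : 1 ≤ ⌊y⌋₊ := Nat.one_le_floor_iff y |>.2 hy1
  have hmy : (⌊y⌋₊ : ℝ) ≤ y := Nat.floor_le (by linarith)
  have hym : y < ⌊y⌋₊ + 1 := Nat.lt_floor_add_one y
  generalize ⌊y⌋₊ = m at *
  obtain ⟨d, rfl⟩ : ∃ d, l = d + 1 := ⟨l - 1, by omega⟩
  have hm1' : (1 : ℝ) ≤ m := by exact_mod_cast hm1
  have hgrid : 2 * (d * (d * m) ^ 2) ≤ n := by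
    have h1 : (m : ℝ) ^ 2 * (2 * ((d + 1 : ℕ) : ℝ) ^ 3) ≤ n := by
      rw [← le_div_iff₀ (by positivity), ← hysq]
      gcongr
    have h2 : m ^ 2 * (2 * (d + 1) ^ 3) ≤ n := by exact_mod_cast h1
    calc 2 * (d * (d * m) ^ 2) = m ^ 2 * (2 * d ^ 3) := by ring
      _ ≤ m ^ 2 * (2 * (d + 1) ^ 3) := by gcongr; omega
      _ ≤ n := h2
  intro R hR
  refine le_trans (EReal.coe_le_coe_iff.2 ?_) (grid_lower_bound hn hm1 hlk hgrid R hR)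
  have hlog : Real.logb 2 (A / ((d + 1 : ℕ) : ℝ) ^ 3 * (Real.pi * Real.exp 1 ^ 3 / 2))
      ≤ 2 * Real.logb 2 (m / 6) := by
    have e : 2 * Real.logb 2 ((m : ℝ) / 6) = Real.logb 2 (((m : ℝ) / 6) ^ 2) := by
      rw [Real.logb_pow]; norm_num
    rw [e]
    apply Real.logb_le_logb_of_le one_lt_two (by positivity)
    -- Since $m\ge1$, $y<m+1\le 2m$; this is the source of $144=(2\cdot 6)^2$.
    have h1 : y ^ 2 / 144 ≤ ((m : ℝ) / 6) ^ 2 := by nlinarith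
    refine le_trans ?_ h1
    rw [hysq, hprod]
    have : A * (Real.pi * Real.exp 1 ^ 3 / 2) ≤ A * E / 2 / 144 := by nlinarith
    calc A / ((d + 1 : ℕ) : ℝ) ^ 3 * (Real.pi * Real.exp 1 ^ 3 / 2)
        = A * (Real.pi * Real.exp 1 ^ 3 / 2) / ((d + 1 : ℕ) : ℝ) ^ 3 := by ring
      _ ≤ A * E / 2 / 144 / ((d + 1 : ℕ) : ℝ) ^ 3 := by gcongr
      _ = _ := by field_simp
  calc (((d + 1 : ℕ) : ℝ) - 1) / (2 * n)
        * Real.logb 2 (A / ((d + 1 : ℕ) : ℝ) ^ 3 * (Real.pi * Real.exp 1 ^ 3 / 2))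
      ≤ (((d + 1 : ℕ) : ℝ) - 1) / (2 * n) * (2 * Real.logb 2 (m / 6)) := by
        apply mul_le_mul_of_nonneg_left hlog
        push_cast
        simp only [add_sub_cancel_right]
        positivity
    _ = _ := by push_cast; field_simp; ring

theorem redundancy_bounds_nonneg {n k : ℕ} (hn : 1 ≤ n) (hk : 1 ≤ k) :
    ∀ R ∈ ({maximinRedundancy n (monotoneClass k),
        minimaxRedundancy n (monotoneClass k)} : Set EReal), 0 ≤ R := by
  intro R hR
  -- A grid with no free coordinate is a single source.
  have := grid_lower_bound (d := 0) (m := 1) hn le_rfl hk (by simp) R hR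
  simpa using this

theorem theorem1 (ε : ℝ) (hε : 0 < ε) :
    ∃ C : ℝ, 0 < C ∧ ∃ N : ℕ, ∀ n k : ℕ, N ≤ n → 1 ≤ n → 1 ≤ k →
      ((k : ℝ) ≤ (Real.pi * (n : ℝ) ^ (1 - ε) / 2) ^ (1 / 3 : ℝ) →
        ∀ R ∈ ({maximinRedundancy n (monotoneClass k),
            minimaxRedundancy n (monotoneClass k)} : Set EReal),
          (((((k : ℝ) - 1) / (2 * n)) * Real.logb 2 ((n : ℝ) ^ (1 - ε) / (k : ℝ) ^ 3)
            + (((k : ℝ) - 1) / (2 * n)) * Real.logb 2 (Real.pi * Real.exp 1 ^ 3 / 2)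
            - C * (Real.logb 2 k / n) : ℝ) : EReal) ≤ R) ∧
      ((Real.pi * (n : ℝ) ^ (1 - ε) / 2) ^ (1 / 3 : ℝ) < (k : ℝ) →
        ∀ R ∈ ({maximinRedundancy n (monotoneClass k),
            minimaxRedundancy n (monotoneClass k)} : Set EReal),
          (((Real.pi / 2) ^ (1 / 3 : ℝ) * (1.5 * Real.logb 2 (Real.exp 1))
              * ((n : ℝ) ^ ((1 - ε) / 3) / n)
            - C * (Real.logb 2 n / n) : ℝ) : EReal) ≤ R) := by
  have he : 0 < Real.logb 2 (Real.exp 1) :=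
    Real.logb_pos one_lt_two (Real.one_lt_exp_iff.2 one_pos)
  obtain ⟨N, hN⟩ := Filter.eventually_atTop.1 <|
    ((tendsto_rpow_atTop hε).comp tendsto_natCast_atTop_atTop).eventually_ge_atTop
      (144 * Real.pi * Real.exp 1 ^ 3)
  -- $C$ is twice $1.5\log e$, so that the second bound reads $1.5\log e\,(K-2\log n)/n$ with $K$
  -- the threshold. Requiring $n\ge2$ makes $\log n\ge1$.
  refine ⟨3 * Real.logb 2 (Real.exp 1), by positivity, max N 2, fun n k hNn hn hk => ⟨?_, ?_⟩⟩
  · have hnε : 144 * Real.pi * Real.exp 1 ^ 3 ≤ (n : ℝ) ^ ε := hN n (le_of_max_le_left hNn)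
    have hn' : (0 : ℝ) < n := by exact_mod_cast hn
    have hk' : (1 : ℝ) ≤ k := by exact_mod_cast hk
    intro hkn R hR
    have hA : 0 < (n : ℝ) ^ (1 - ε) := Real.rpow_pos_of_pos hn' _
    have hk3 : (k : ℝ) ^ 3 ≤ Real.pi * (n : ℝ) ^ (1 - ε) / 2 := by
      refine (pow_le_pow_left₀ (by positivity) hkn 3).trans (le_of_eq ?_)
      rw [← Real.rpow_natCast, ← Real.rpow_mul (by positivity)]
      norm_num
    refine le_trans (EReal.coe_le_coe_iff.2 ?_) (small_alphabet_bound hn hk le_rfl hk3 hnε R hR)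
    rw [Real.logb_mul (by positivity) (by positivity), mul_add]
    have := Real.logb_nonneg one_lt_two hk'
    have : 0 ≤ 3 * Real.logb 2 (Real.exp 1) * (Real.logb 2 k / n) := by positivity
    linarith
  · have hnε : 144 * Real.pi * Real.exp 1 ^ 3 ≤ (n : ℝ) ^ ε := hN n (le_of_max_le_left hNn)
    have hn' : (0 : ℝ) < n := by exact_mod_cast hn
    have hn2 : (2 : ℝ) ≤ n := by exact_mod_cast le_of_max_le_right hNn
    have hlogn : 1 ≤ Real.logb 2 n := by
      rw [Real.le_logb_iff_rpow_le one_lt_two hn']; simpa using hn2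
    intro hkn R hR
    have hA : 0 < (n : ℝ) ^ (1 - ε) := Real.rpow_pos_of_pos hn' _
    have hKeq : (Real.pi * (n : ℝ) ^ (1 - ε) / 2) ^ (1 / 3 : ℝ)
        = (Real.pi / 2) ^ (1 / 3 : ℝ) * (n : ℝ) ^ ((1 - ε) / 3) := by
      rw [mul_div_right_comm, Real.mul_rpow (by positivity) hA.le, ← Real.rpow_mul hn'.le]
      ring_nf
    have hK3 : ((Real.pi * (n : ℝ) ^ (1 - ε) / 2) ^ (1 / 3 : ℝ)) ^ 3
        = Real.pi * (n : ℝ) ^ (1 - ε) / 2 := by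
      rw [← Real.rpow_natCast, ← Real.rpow_mul (by positivity)]
      norm_num
    have hK0 : 0 < (Real.pi * (n : ℝ) ^ (1 - ε) / 2) ^ (1 / 3 : ℝ) := by positivity
    have hrw : (Real.pi / 2) ^ (1 / 3 : ℝ) * (1.5 * Real.logb 2 (Real.exp 1))
          * ((n : ℝ) ^ ((1 - ε) / 3) / n)
        - 3 * Real.logb 2 (Real.exp 1) * (Real.logb 2 n / n)
        = 1.5 * Real.logb 2 (Real.exp 1)
          * ((Real.pi * (n : ℝ) ^ (1 - ε) / 2) ^ (1 / 3 : ℝ) - 2 * Real.logb 2 n) / n := by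
      rw [hKeq]; ring
    rw [hrw]
    generalize (Real.pi * (n : ℝ) ^ (1 - ε) / 2) ^ (1 / 3 : ℝ) = K at *
    -- If $K<1$ no letter fits below the threshold, but then the claimed bound is negative.
    rcases lt_or_ge K 1 with hK1 | hK1
    · refine le_trans ?_ (redundancy_bounds_nonneg hn hk R hR)
      refine EReal.coe_nonpos.2 (div_nonpos_of_nonpos_of_nonneg ?_ hn'.le)
      exact mul_nonpos_of_nonneg_of_nonpos (by positivity) (by linarith)
    · have hl1 : 1 ≤ ⌊K⌋₊ := (Nat.one_le_floor_iff K).2 hK1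
      have hlK : (⌊K⌋₊ : ℝ) ≤ K := Nat.floor_le hK0.le
      have hKl : K < ⌊K⌋₊ + 1 := Nat.lt_floor_add_one K
      have hlk : ⌊K⌋₊ ≤ k := by exact_mod_cast hlK.trans hkn.le
      generalize ⌊K⌋₊ = l at *
      have hl1' : (1 : ℝ) ≤ l := by exact_mod_cast hl1
      have hl3 : (l : ℝ) ^ 3 ≤ Real.pi * (n : ℝ) ^ (1 - ε) / 2 := by
        rw [← hK3]; gcongr
      refine le_trans (EReal.coe_le_coe_iff.2 ?_)
        (small_alphabet_bound hn hl1 hlk hl3 hnε R hR)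
      -- At $l\le K$ the factor $\pi n^{1-\varepsilon}/(2l^3)$ is at least $1$, leaving $e^3$.
      have hlog : 3 * Real.logb 2 (Real.exp 1) ≤ Real.logb 2
          ((n : ℝ) ^ (1 - ε) / (l : ℝ) ^ 3 * (Real.pi * Real.exp 1 ^ 3 / 2)) := by
        have e : 3 * Real.logb 2 (Real.exp 1) = Real.logb 2 (Real.exp 1 ^ 3) := by
          rw [Real.logb_pow]; norm_num
        rw [e]
        apply Real.logb_le_logb_of_le one_lt_two (by positivity)
        calc Real.exp 1 ^ 3 = 1 * Real.exp 1 ^ 3 := (one_mul _).symm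
          _ ≤ Real.pi * (n : ℝ) ^ (1 - ε) / 2 / (l : ℝ) ^ 3 * Real.exp 1 ^ 3 := by
            gcongr
            rwa [one_le_div (by positivity)]
          _ = _ := by ring
      calc 1.5 * Real.logb 2 (Real.exp 1) * (K - 2 * Real.logb 2 n) / n
          ≤ 1.5 * Real.logb 2 (Real.exp 1) * (l - 1) / n := by
            gcongr ?_ / _
            -- Rounding and the first letter lose less than $2\le 2\log n$: $l-1>K-2$.
            exact mul_le_mul_of_nonneg_left (by linarith) (by positivity)
        _ = ((l : ℝ) - 1) / (2 * n) * (3 * Real.logb 2 (Real.exp 1)) := by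
            field_simp; norm_num; ring
        _ ≤ _ := by
            apply mul_le_mul_of_nonneg_left hlog
            exact div_nonneg (by linarith) (by positivity)
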